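/- All digraphs are finite, without loops and without parallel arcs (arcs $uv$ and $vu$ may both be present). A digraph $D=(V,A)$ is \emph{semicomplete multipartite} with \emph{partite sets} $V_1,\dots,V_c$ if these form a partition of $V$, no arc of $D$ has both ends in the same $V_i$, and for all $u\in V_i$, $v\in V_j$ with $i\neq j$ at least one of the arcs $uv$, $vu$ is in $A$. A digraph is \emph{strong} if for every ordered pair of distinct vertices $u,v$ it contains a directed path from $u$ to $v$, and it is \emph{$k$-strong} if $|V|\ge k+1$ and $D-X$ is strong for every $X\subset V$ with $|X|\le k-1$. For distinct vertices $x,y$, an \emph{$(x,y)$-G-path} (generalized path) of a semicomplete multipartite digraph $D$ is a sequence of $r\ge 1$ pairwise vertex-disjoint directed paths $P_1,\dots,P_r$ of $D$ (single vertices are allowed as paths), where $P_i$ starts in $u_i$ and ends in $v_i$, such that $u_1=x$, $v_r=y$, and for each $1\le i<r$ the vertices $v_i$ and $u_{i+1}$ belong to the same partite set of $D$. It is \emph{spanning} if every vertex of $D$ lies on one of the paths $P_i$. \textbf{Corollary.} Let $D$ be a $4$-strong semicomplete multipartite digraph. Then for every choice of distinct vertices $x,y$ of $D$ there is a spanning $(x,y)$-G-path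 in $D$. -/

import Mathlib

namespace Digraph

/-- `D.IsDipath u v p`: the list of vertices `p` is a directed `(u,v)`-path of `D`, i.e. a
nonempty sequence of distinct vertices that starts in `u`, ends in `v`, and in which every vertex
dominates its successor. A single vertex is a path of length `0`. -/
structure IsDipath {V : Type*} (D : Digraph V) (u v : V) (p : List V) : Prop where
  head_eq : p.head? = some u
  last_eq : p.getLast? = some v
  nodup : p.Nodup
  chain : p.IsChain D.Adj

/-- A digraph is strong if for every ordered pair of distinct vertices `x`, `y` there is
a directed `(x,y)`-path. -/
def Strong {V : Type*} (D : Digraph V) : Prop :=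
  ∀ x y : V, x ≠ y → ∃ p : List V, D.IsDipath x y p

/-- The digraph `D - X` obtained from `D` by deleting the vertices in `X`. -/
def deleteVertices {V : Type*} (D : Digraph V) (X : Set V) : Digraph {v : V // v ∉ X} where
  Adj u v := D.Adj u v

/-- A finite digraph is `k`-strong if it has at least `k + 1` vertices and `D - X` is strong for
every set `X` of at most `k - 1` vertices. -/
def KStrong {V : Type*} (D : Digraph V) (k : ℕ) : Prop :=
  k + 1 ≤ Nat.card V ∧ ∀ X : Finset V, X.card < k → (D.deleteVertices (X : Set V)).Strong

/-- `D` is semicomplete multipartite, and its partite sets are the classes of the equivalence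
relation `P`: there is no arc with both ends in the same class, and there is
at least one arc between any two vertices in different classes. -/
structure IsSemicompleteMultipartite {V : Type*} (D : Digraph V) (P : Setoid V) : Prop where
  not_adj : ∀ u v : V, P u v → ¬ D.Adj u v
  adj_or_adj : ∀ u v : V, ¬ P u v → D.Adj u v ∨ D.Adj v u

/-- `D.IsGPath P x y L`: the list `L` of vertex sequences is a generalized `(x,y)`-path of the
semicomplete multipartite digraph `D` whose partite sets are the classes of `P`. It consists of
`r ≥ 1` pairwise vertex-disjoint directed paths of `D`, the first one starting in `x`, the last one
ending in `y`, such that the end of each path and the start of the next one lie in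
the same partite set. -/
structure IsGPath {V : Type*} (D : Digraph V) (P : Setoid V) (x y : V) (L : List (List V)) :
    Prop where
  isDipath : ∀ p ∈ L, ∃ u v : V, D.IsDipath u v p
  disjoint : L.Pairwise List.Disjoint
  link : L.IsChain (fun p q => ∃ v ∈ p.getLast?, ∃ u ∈ q.head?, P v u)
  start : ∃ p ∈ L.head?, p.head? = some x
  finish : ∃ p ∈ L.getLast?, p.getLast? = some y

end Digraph

/-! Let `r` relate two vertices when they are joined by an arc or lie in the same partite set. Then
`r` is total and reflexive, and cutting a Hamiltonian `r`-path at steps that are not arcs gives a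
spanning G-path. So the claim reduces to Thomassen's theorem on Hamiltonian `(x,y)`-paths, for total
relations.

Hall's theorem, used in place of Menger's, gives three internally disjoint `(x,y)`-paths with inner
vertices (`exists_pathSystem`). Take such a system covering as many vertices as possible. Since
chains with common ends merge as in merge sort (`exists_merge`, `exists_absorb`), no walk through
the set `W` of missed vertices leads forward along one path (`noEar`). If `W` is empty, the three
paths merge. Otherwise, a Hamiltonian path of `W` entered from the end of one path and left to the
start of another joins these two, and the third is absorbed (`hasHamPath_of_twist`). If `W` is
strong, going round a Hamiltonian cycle of `W` finds such a twist. If it is not, either a twist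
exists or the missed vertices can be interleaved with the three paths (`hasHamPath_of_interleave`).
-/

namespace TotalRelation

variable {V : Type*} {r : V → V → Prop}

/-! ### Merging chains of a total relation -/

/-- Two chains from `u` to a common tail can be merged into one. -/
theorem exists_merge (ht : ∀ u v, r u v ∨ r v u) : ∀ (u : V) (s e t : List V),
    (u :: (s ++ t)).IsChain r → (u :: (e ++ t)).IsChain r →
    ∃ m : List V, (u :: (m ++ t)).IsChain r ∧ m.Perm (s ++ e) ∧ s.Sublist m
  | u, [], e, t, _, h2 => ⟨e, h2, by simp, by simp⟩
  | u, a :: s, [], t, h1, _ => ⟨a :: s, h1, by simp, by simp⟩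
  | u, a :: s, b :: e, t, h1, h2 => by
    simp only [List.cons_append, List.isChain_cons_cons] at h1 h2
    -- Whichever head dominates the other is output next; both remaining chains can then start from
    -- it.
    rcases ht a b with hab | hba
    · obtain ⟨m, hm, hp, hs⟩ := exists_merge ht a s (b :: e) t h1.2
        (by simpa only [List.cons_append, List.isChain_cons_cons] using ⟨hab, h2.2⟩)
      refine ⟨a :: m, ?_, by simpa using hp, by simpa using hs⟩
      simpa only [List.cons_append, List.isChain_cons_cons] using ⟨h1.1, hm⟩
    · obtain ⟨m, hm, hp, hs⟩ := exists_merge ht b (a :: s) e t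
        (by simpa only [List.cons_append, List.isChain_cons_cons] using ⟨hba, h1.2⟩) h2.2
      refine ⟨b :: m, ?_, ?_, hs.trans (List.sublist_cons_self _ _)⟩
      · simpa only [List.cons_append, List.isChain_cons_cons] using ⟨h2.1, hm⟩
      · exact (hp.cons b).trans (List.perm_middle.symm)
termination_by _ s e => s.length + e.length

/-- A forward ear of a chain can be absorbed into the chain. -/
theorem exists_absorb (ht : ∀ u v, r u v ∨ r v u) {Q e : List V} {u v : V}
    (hQ : Q.IsChain r) (huv : [u, v].Sublist Q) (he : (u :: (e ++ [v])).IsChain r) :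
    ∃ Q' : List V, Q'.IsChain r ∧ Q'.Perm (Q ++ e) ∧ Q'.head? = Q.head? ∧
      Q'.getLast? = Q.getLast? ∧ Q.Sublist Q' := by
  obtain ⟨q₁, q₂, rfl, hu, hv⟩ := List.cons_sublist_iff.1 huv
  obtain ⟨p, s₀, rfl⟩ := List.append_of_mem hu
  obtain ⟨s₁, t, rfl⟩ := List.append_of_mem (List.singleton_sublist.1 hv)
  have hQ' : (p ++ u :: ((s₀ ++ s₁) ++ v :: t)).IsChain r := by simpa using hQ
  obtain ⟨hp, hst⟩ := List.isChain_split.1 hQ'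
  have ht' : (v :: t).IsChain r := hst.suffix ⟨u :: (s₀ ++ s₁), by simp⟩
  have he' : (u :: (e ++ v :: t)).IsChain r := by
    have := (List.isChain_split (l₁ := u :: e) (l₂ := t)).2 ⟨by simpa using he, ht'⟩
    simpa using this
  obtain ⟨m, hm, hperm, hsub⟩ := exists_merge ht u (s₀ ++ s₁) e (v :: t) hst he'
  refine ⟨p ++ u :: (m ++ v :: t), List.isChain_split.2 ⟨hp, hm⟩, ?_, ?_, ?_, ?_⟩
  · have h1 : (m ++ v :: t).Perm ((s₀ ++ s₁) ++ v :: t ++ e) := by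
      refine (hperm.append_right _).trans ?_
      rw [List.append_assoc, List.append_assoc (s₀ ++ s₁)]
      exact List.perm_append_comm.append_left _
    have := (h1.cons u).append_left p
    simpa using this
  · cases p <;> simp
  · have h0 : ∀ a : List V, (a ++ v :: t).getLast? = (v :: t).getLast? :=
      fun a => List.getLast?_append_of_ne_nil _ (by simp)
    have := (h0 (p ++ u :: m)).trans (h0 (p ++ u :: s₀ ++ s₁)).symm
    simpa using this
  · have : ((s₀ ++ s₁) ++ v :: t).Sublist (m ++ v :: t) := hsub.append_right _
    have := (this.cons_cons u).append_left p
    simpa using this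

/-! ### Reachability inside a set -/

/-- `b` can be reached from `a` by a walk whose vertices after `a` lie in `S`. -/
def ReachIn (r : V → V → Prop) (S : Set V) : V → V → Prop :=
  Relation.ReflTransGen fun a b => r a b ∧ b ∈ S

theorem ReachIn.mem {S : Set V} {a b : V} (h : ReachIn r S a b) (ha : a ∈ S) : b ∈ S := by
  induction h with
  | refl => exact ha
  | tail _ h _ => exact h.2

theorem ReachIn.exists_path {S : Set V} {a b : V} (h : ReachIn r S a b) (ha : a ∈ S) :
    ∃ l : List V, (a :: l).IsChain r ∧ (a :: l).Nodup ∧ (∀ z ∈ a :: l, z ∈ S) ∧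
      (a :: l).getLast? = some b := by
  induction h using Relation.ReflTransGen.head_induction_on with
  | refl => exact ⟨[], by simp, by simp, by simpa using ha, by simp⟩
  | @head a c hac _ ih =>
    obtain ⟨l, hl, hn, hS, hb⟩ := ih hac.2
    by_cases hm : a ∈ c :: l
    · obtain ⟨s, t, hst⟩ := List.append_of_mem hm
      rw [hst] at hl hn hS hb
      exact ⟨t, hl.right_of_append, hn.of_append_right, fun z hz => hS z (by simp_all),
        by simpa [List.getLast?_append] using hb⟩
    · refine ⟨c :: l, List.isChain_cons_cons.2 ⟨hac.1, hl⟩, List.nodup_cons.2 ⟨hm, hn⟩, ?_, ?_⟩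
      · intro z hz
        rcases List.mem_cons.1 hz with rfl | hz
        exacts [ha, hS z hz]
      · rw [List.getLast?_cons_cons, hb]

theorem ReachIn.exists_cross {S : Set V} {a b : V} (h : ReachIn r S a b) {C : Set V}
    (ha : a ∈ C) (hb : b ∉ C) : ∃ u ∈ C, ∃ v, v ∉ C ∧ v ∈ S ∧ r u v := by
  induction h with
  | refl => exact absurd ha hb
  | @tail c d _ hcd ih =>
    by_cases hc : c ∈ C
    · exact ⟨c, hc, d, hb, hcd.2, hcd.1⟩
    · exact ih hc

theorem ReachIn.exists_hit {S : Set V} {a b : V} (h : ReachIn r S a b) {C : Set V}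
    (ha : a ∉ C) (hb : b ∈ C) : ∃ w, ReachIn r (S \ C) a w ∧ ∃ v ∈ C, r w v := by
  induction h using Relation.ReflTransGen.head_induction_on with
  | refl => exact absurd hb ha
  | @head a c hac _ ih =>
    by_cases hc : c ∈ C
    · exact ⟨a, .refl, c, hc, hac.1⟩
    · obtain ⟨w, hw, hv⟩ := ih hc
      exact ⟨w, .head ⟨hac.1, hac.2, hc⟩ hw, hv⟩

/-! ### Hamiltonian paths and cycles: Rédei and Camion -/

theorem exists_max_of_bounded {α : Type*} {p : α → Prop} (f : α → ℕ) (N : ℕ)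
    (hN : ∀ a, p a → f a ≤ N) (h : ∃ a, p a) : ∃ a, p a ∧ ∀ b, p b → f b ≤ f a := by
  obtain ⟨a, ha, hmin⟩ := (measure fun a => N - f a).wf.has_min {a | p a} h
  refine ⟨a, ha, fun b hb => ?_⟩
  have h1 : ¬ (N - f b < N - f a) := hmin b hb
  have := hN a ha
  have := hN b hb
  omega

/-- A vertex that reaches all of `S` inside `S` is the start of a Hamiltonian path of `S`. -/
theorem exists_hamiltonian_from [Finite V] (ht : ∀ u v, r u v ∨ r v u) {S : Set V} {a : V}
    (ha : a ∈ S) (h : ∀ z ∈ S, ReachIn r S a z) :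
    ∃ l : List V, (a :: l).IsChain r ∧ (a :: l).Nodup ∧ ∀ z, z ∈ a :: l ↔ z ∈ S := by
  classical
  have := Fintype.ofFinite V
  obtain ⟨l, ⟨hl, hn, hS⟩, hmax⟩ := exists_max_of_bounded
    (p := fun l : List V => (a :: l).IsChain r ∧ (a :: l).Nodup ∧ ∀ z ∈ a :: l, z ∈ S)
    List.length (Fintype.card V) (fun l hl => (List.nodup_cons.1 hl.2.1).2.length_le_card)
    ⟨[], by simp, by simp, by simpa using ha⟩
  refine ⟨l, hl, hn, fun z => ⟨hS z, fun hz => ?_⟩⟩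
  by_contra hzl
  obtain ⟨u, hu, v, hv, hvS, huv⟩ :=
    (h z hz).exists_cross (C := {z | z ∈ a :: l}) (by simp) hzl
  obtain ⟨p, s, hps⟩ := List.append_of_mem (show u ∈ a :: l from hu)
  rw [hps] at hl
  obtain ⟨hp, hs⟩ := List.isChain_split.1 hl
  -- With empty common tail the end is free, so `v` merges into what follows `u`; the start `a` is
  -- kept.
  obtain ⟨m, hm, hperm, -⟩ := exists_merge ht u s [v] [] (by simpa using hs) (by simpa using huv)
  have hnew : (p ++ u :: m).IsChain r := List.isChain_split.2 ⟨hp, by simpa using hm⟩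
  have hperm' : (p ++ u :: m).Perm (v :: a :: l) := by
    rw [hps]
    refine ((hperm.cons u).append_left p).trans ?_
    have : p ++ u :: (s ++ [v]) = (p ++ u :: s) ++ [v] := by simp
    rw [this]
    exact List.perm_append_singleton _ _
  obtain ⟨l', hl'⟩ : ∃ l', p ++ u :: m = a :: l' := by
    cases p with
    | nil => simp only [List.nil_append, List.cons.injEq] at hps ⊢; exact ⟨m, hps.1.symm, rfl⟩
    | cons b p =>
      simp only [List.cons_append, List.cons.injEq] at hps ⊢
      exact ⟨_, hps.1.symm, rfl⟩
  rw [hl'] at hnew hperm'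
  have h1 := hmax l' ⟨hnew, hperm'.nodup_iff.2 (List.nodup_cons.2 ⟨hv, hn⟩), fun z hz => by
    rcases List.mem_cons.1 (hperm'.mem_iff.1 hz) with rfl | hz
    exacts [hvS, hS z hz]⟩
  have h2 := hperm'.length_eq
  simp at h2
  omega

/-- Every finite set of vertices has a Hamiltonian path (Rédei). -/
theorem exists_chain_perm (ht : ∀ u v, r u v ∨ r v u) (l : List V) :
    ∃ m : List V, m.IsChain r ∧ m.Perm l := by
  induction l with
  | nil => exact ⟨[], by simp, by simp⟩
  | cons a l ih =>
    obtain ⟨m, hm, hperm⟩ := ih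
    cases m with
    | nil => exact ⟨[a], by simp, by simpa using hperm⟩
    | cons b m =>
      rcases ht a b with h | h
      · exact ⟨a :: b :: m, List.isChain_cons_cons.2 ⟨h, hm⟩, hperm.cons a⟩
      · obtain ⟨m', hm', hp, -⟩ :=
          exists_merge ht b m [a] [] (by simpa using hm) (by simpa using h)
        refine ⟨b :: m', by simpa using hm', ?_⟩
        refine (hp.cons b).trans (.trans ?_ (hperm.cons a))
        exact List.perm_append_singleton a (b :: m)

/-- `s` and `s'` are the end and the start of a Hamiltonian path of `S`. -/
def HamSucc (r : V → V → Prop) (S : Set V) (s s' : V) : Prop :=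
  ∃ l : List V, l.IsChain r ∧ l.Nodup ∧ (∀ z, z ∈ l ↔ z ∈ S) ∧ l.head? = some s' ∧
    l.getLast? = some s

/-- A strong set of vertices has a Hamiltonian cycle (Camion). -/
theorem exists_closed_chain [Finite V] (ht : ∀ u v, r u v ∨ r v u) {S : Set V} (hne : S.Nonempty)
    (h : ∀ a ∈ S, ∀ b ∈ S, ReachIn r S a b) :
    ∃ (c : V) (l : List V), (c :: (l ++ [c])).IsChain r ∧ (c :: l).Nodup ∧
      ∀ z, z ∈ c :: l ↔ z ∈ S := by
  classical
  have := Fintype.ofFinite V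
  obtain ⟨a, ha⟩ := hne
  obtain ⟨⟨c, l⟩, ⟨hl, hn, hS⟩, hmax⟩ := exists_max_of_bounded
    (p := fun q : V × List V => (q.1 :: (q.2 ++ [q.1])).IsChain r ∧ (q.1 :: q.2).Nodup ∧
      ∀ z ∈ q.1 :: q.2, z ∈ S)
    (fun q => q.2.length) (Fintype.card V)
    (fun l hl => (List.nodup_cons.1 hl.2.1).2.length_le_card)
    -- Totality includes loops, so a single vertex counts as a closed chain.
    ⟨(a, []), by simpa using ht a a, by simp, by simpa using ha⟩
  dsimp only at hl hn hS hmax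
  refine ⟨c, l, hl, hn, fun z => ⟨hS z, fun hz => ?_⟩⟩
  by_contra hzl
  have hcS : c ∈ S := hS c (by simp)
  obtain ⟨u, hu, w, hw, hwS, huw⟩ :=
    (h c hcS z hz).exists_cross (C := {z | z ∈ c :: l}) (by simp) hzl
  obtain ⟨w', hw', v, hv, hwv⟩ :=
    (h w hwS c hcS).exists_hit (C := {z | z ∈ c :: l}) hw (by simp)
  obtain ⟨e, he, hen, heS, hlast⟩ := hw'.exists_path ⟨hwS, hw⟩
  -- Rotate the cycle to run from `u` back to `u`. Every ear leaving at `u` then points forward,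
  -- even when it returns to `u`.
  obtain ⟨k, hk, hkperm⟩ : ∃ k : List V, (u :: (k ++ [u])).IsChain r ∧
      (u :: k).Perm (c :: l) := by
    rcases List.mem_cons.1 (show u ∈ c :: l from hu) with rfl | hu
    · exact ⟨l, hl, .refl _⟩
    · obtain ⟨p, s, rfl⟩ := List.append_of_mem hu
      have h0 : ((c :: p) ++ u :: (s ++ [c])).IsChain r := by simpa using hl
      obtain ⟨h1, h2⟩ := List.isChain_split.1 h0
      refine ⟨s ++ c :: p, ?_, ?_⟩
      · have := (List.isChain_split (l₁ := u :: s) (c := c) (l₂ := p ++ [u])).2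
          ⟨by simpa using h2, by simpa using h1⟩
        simpa using this
      · simpa using List.perm_append_comm (l₁ := u :: s) (l₂ := c :: p)
  have hv' : v ∈ k ++ [u] := by
    have := hkperm.mem_iff.2 (show v ∈ c :: l from hv)
    simp only [List.mem_cons, List.mem_append, List.not_mem_nil, or_false] at this ⊢
    tauto
  obtain ⟨s, t, hst⟩ := List.append_of_mem hv'
  rw [hst] at hk
  have htc : (v :: t).IsChain r := hk.suffix ⟨u :: s, by simp⟩
  have hec : (u :: (w :: e ++ v :: t)).IsChain r := by
    rw [List.cons_append, List.isChain_cons_cons, ← List.cons_append, List.isChain_append]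
    refine ⟨huw, he, htc, fun x hx y hy => ?_⟩
    rw [hlast] at hx
    simp only [Option.mem_def, Option.some.injEq, List.head?_cons] at hx hy
    rw [← hx, ← hy]
    exact hwv
  obtain ⟨m, hm, hmp, -⟩ := exists_merge ht u s (w :: e) (v :: t) hk hec
  obtain ⟨t', ht'⟩ : ∃ t', v :: t = t' ++ [u] := by
    rcases List.eq_nil_or_concat t with rfl | ⟨t', b, rfl⟩
    · refine ⟨[], ?_⟩
      have := congrArg List.getLast? hst
      rw [List.getLast?_concat, List.getLast?_concat, Option.some.injEq] at this
      simp [this]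
    · refine ⟨v :: t', ?_⟩
      have h0 : k ++ [u] = (s ++ v :: t') ++ [b] := by simpa using hst
      have := congrArg List.getLast? h0
      rw [List.getLast?_concat, List.getLast?_concat, Option.some.injEq] at this
      simp [this]
  have hk' : k = s ++ t' := by
    rw [ht', ← List.append_assoc] at hst
    exact List.append_cancel_right hst
  have hperm : (u :: (m ++ t')).Perm (c :: l ++ w :: e) := by
    refine .trans ?_ (hkperm.append_right _)
    rw [hk']
    refine ((hmp.append_right t').cons u).trans ?_
    have := ((List.perm_append_comm (l₁ := w :: e) (l₂ := t')).append_left s).cons u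
    simpa using this
  have h1 := hmax (u, m ++ t') ⟨by rw [ht'] at hm; simpa using hm, ?_, ?_⟩
  · have := hperm.length_eq
    simp at this h1
    omega
  · refine hperm.nodup_iff.2 (List.nodup_append.2 ⟨hn, hen, ?_⟩)
    rintro x hx y hy rfl
    exact (heS x hy).2 hx
  · intro x hx
    rcases List.mem_append.1 (hperm.mem_iff.1 hx) with hx | hx
    exacts [hS x hx, (heS x hx).1]

/-- Removing the arc from `s` to `s'` from a Hamiltonian cycle leaves a Hamiltonian path from `s'`
to `s`. Thus `HamSucc` holds along the cycle, and going round it connects any two vertices. -/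
theorem exists_hamSucc [Finite V] (ht : ∀ u v, r u v ∨ r v u) {S : Set V} (hne : S.Nonempty)
    (h : ∀ a ∈ S, ∀ b ∈ S, ReachIn r S a b) :
    (∀ a ∈ S, ∃ b ∈ S, HamSucc r S a b) ∧
      ∀ a ∈ S, ∀ b ∈ S, Relation.ReflTransGen (HamSucc r S) a b := by
  obtain ⟨c, l, hl, hn, hS⟩ := exists_closed_chain ht hne h
  have hch : (c :: (l ++ [c])).IsChain (HamSucc r S) := by
    rw [List.isChain_iff_forall_rel_of_append_cons_cons]
    intro s s' p t hpt
    have hl' := hl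
    rw [hpt] at hl'
    rcases List.eq_nil_or_concat t with rfl | ⟨t, d, rfl⟩
    · have h0 : (c :: l) ++ [c] = (p ++ [s]) ++ [s'] := by simpa using hpt
      obtain ⟨h1, h2⟩ := List.append_inj' h0 rfl
      obtain rfl : c = s' := by simpa using h2
      exact ⟨c :: l, hl.prefix ⟨[c], by simp⟩, hn, hS, by simp, by rw [h1]; simp⟩
    · have h0 : (c :: l) ++ [c] = (p ++ s :: s' :: t) ++ [d] := by simpa using hpt
      obtain ⟨h1, h2⟩ := List.append_inj' h0 rfl
      obtain rfl : c = d := by simpa using h2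
      have hperm : (s' :: t ++ (p ++ [s])).Perm (c :: l) := by
        rw [h1]
        have := List.perm_append_comm (l₁ := s' :: t) (l₂ := p ++ [s])
        simpa using this
      refine ⟨s' :: t ++ (p ++ [s]), ?_, hperm.nodup_iff.2 hn,
        fun z => hperm.mem_iff.trans (hS z), by simp,
        by rw [← List.append_assoc, List.getLast?_concat]⟩
      obtain ⟨q, hq⟩ : ∃ q, p ++ [s] = c :: q := by
        cases p with
        | nil => simp at h1; exact ⟨[], by simp [h1.1]⟩
        | cons b p => simp at h1; exact ⟨p ++ [s], by simp [h1.1]⟩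
      rw [hq]
      refine List.isChain_split.2 ⟨hl'.suffix ⟨p ++ [s], by simp⟩, ?_⟩
      rw [← hq]
      exact hl'.prefix ⟨s' :: t ++ [c], by simp⟩
  have hfrom : ∀ b ∈ S, Relation.ReflTransGen (HamSucc r S) c b := by
    intro b hb
    obtain ⟨p, s, hps⟩ := List.append_of_mem ((hS b).2 hb)
    have h1 : (p ++ [b]).IsChain (HamSucc r S) :=
      hch.prefix ⟨s ++ [c], by rw [← List.cons_append, hps]; simp⟩
    cases p with
    | nil => simp at hps; rw [hps.1]
    | cons d p =>
      simp at hps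
      rw [← hps.1] at h1
      exact List.relationReflTransGen_of_exists_isChain_cons (p ++ [b]) (by simpa using h1) (by simp)
  have hto : ∀ a ∈ S, ∃ b ∈ S, HamSucc r S a b ∧ Relation.ReflTransGen (HamSucc r S) b c := by
    intro a ha
    obtain ⟨p, s, hps⟩ := List.append_of_mem ((hS a).2 ha)
    have h0 : c :: (l ++ [c]) = p ++ a :: (s ++ [c]) := by rw [← List.cons_append, hps]; simp
    have h1 : (a :: (s ++ [c])).IsChain (HamSucc r S) := hch.suffix ⟨p, h0.symm⟩
    obtain ⟨b, s', hs'⟩ : ∃ b s', s ++ [c] = b :: s' := by cases s <;> simp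
    rw [hs', List.isChain_cons_cons] at h1
    refine ⟨b, ?_, h1.1, ?_⟩
    · obtain ⟨k, _, _, hk, hb, _⟩ := h1.1
      exact (hk b).1 (List.mem_of_head? hb)
    · refine List.relationReflTransGen_of_exists_isChain_cons s' h1.2 ?_
      simp [← hs']
  refine ⟨fun a ha => ?_, fun a ha b hb => ?_⟩
  · obtain ⟨b, hb, h1, -⟩ := hto a ha
    exact ⟨b, hb, h1⟩
  · obtain ⟨d, hd, h1, h2⟩ := hto a ha
    exact (Relation.ReflTransGen.head h1 h2).trans (hfrom b hb)

/-! ### Systems of three paths and their ears -/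

/-- Three internally disjoint `(x,y)`-paths, given by the lists `A i` of their inner vertices,
each with at least one inner vertex. -/
structure IsPathSystem (r : V → V → Prop) (x y : V) (A : Fin 3 → List V) : Prop where
  ne_nil : ∀ i, A i ≠ []
  chain : ∀ i, (x :: (A i ++ [y])).IsChain r
  nodup : ∀ i, (A i).Nodup
  disjoint : ∀ i j, i ≠ j → (A i).Disjoint (A j)
  left_notMem : ∀ i, x ∉ A i
  right_notMem : ∀ i, y ∉ A i

/-- The vertices missed by a path system. -/
def missed (x y : V) (A : Fin 3 → List V) : Set V :=
  {v | v ≠ x ∧ v ≠ y ∧ ∀ i, v ∉ A i}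

/-- There is a Hamiltonian `(x,y)`-path. -/
def HasHamPath (r : V → V → Prop) (x y : V) : Prop :=
  ∃ l : List V, l.IsChain r ∧ l.Nodup ∧ (∀ v, v ∈ l) ∧ l.head? = some x ∧ l.getLast? = some y

/-- The ear is spliced into its own path by `exists_absorb`; its vertices are missed, so the other
two paths remain disjoint from it. -/
theorem IsPathSystem.exists_extend (ht : ∀ u v, r u v ∨ r v u) {x y : V} {A : Fin 3 → List V}
    (hA : IsPathSystem r x y A) {i : Fin 3} {u v : V} {e : List V}
    (huv : [u, v].Sublist (x :: (A i ++ [y]))) (he : (u :: (e ++ [v])).IsChain r)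
    (hn : e.Nodup) (hne : e ≠ []) (hW : ∀ z ∈ e, z ∈ missed x y A) :
    ∃ A' : Fin 3 → List V, IsPathSystem r x y A' ∧
      ∑ i, (A i).length < ∑ i, (A' i).length := by
  obtain ⟨Q, hQ, hperm, hhead, hlast, -⟩ := exists_absorb ht (hA.chain i) huv he
  obtain ⟨B, rfl⟩ : ∃ B, Q = x :: (B ++ [y]) := by
    cases Q with
    | nil => simp at hhead
    | cons a Q =>
      simp only [List.head?_cons, Option.some.injEq] at hhead
      subst hhead
      rcases List.eq_nil_or_concat Q with rfl | ⟨B, b, rfl⟩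
      · have := hperm.length_eq
        simp at this
      · rw [List.concat_eq_append, ← List.cons_append, ← List.cons_append, List.getLast?_concat,
          List.getLast?_concat, Option.some.injEq] at hlast
        exact ⟨B, by simp [hlast]⟩
  have hB : B.Perm (A i ++ e) := by
    have h1 : (B ++ [y]).Perm (A i ++ [y] ++ e) := by
      simpa using hperm
    have h2 : (A i ++ [y] ++ e).Perm (A i ++ e ++ [y]) := by
      rw [List.append_assoc, List.append_assoc]
      exact List.perm_append_comm.append_left _
    exact (List.perm_append_right_iff _).1 (h1.trans h2)
  have hmem : ∀ z, z ∈ B ↔ z ∈ A i ∨ z ∈ e := fun z => by rw [hB.mem_iff, List.mem_append]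
  refine ⟨Function.update A i B, ⟨fun j => ?_, fun j => ?_, fun j => ?_, fun j k hjk => ?_,
    fun j => ?_, fun j => ?_⟩, ?_⟩
  · by_cases h : j = i
    · subst h
      rw [Function.update_self]
      intro h0
      rw [h0] at hB
      have := hB.length_eq
      simp only [List.length_nil, List.length_append] at this
      have := List.length_pos_iff.2 hne
      omega
    · rw [Function.update_of_ne h]; exact hA.ne_nil j
  · by_cases h : j = i
    · subst h
      rwa [Function.update_self]
    · rw [Function.update_of_ne h]; exact hA.chain j
  · by_cases h : j = i
    · subst h
      rw [Function.update_self]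
      refine hB.nodup_iff.2 (List.nodup_append.2 ⟨hA.nodup j, hn, ?_⟩)
      rintro a ha b hb rfl
      exact (hW a hb).2.2 j ha
    · rw [Function.update_of_ne h]; exact hA.nodup j
  · intro a ha hb
    have key : ∀ k, k ≠ i → a ∈ A k → a ∈ B → False := by
      intro k hk h1 h2
      rcases (hmem a).1 h2 with h | h
      · exact hA.disjoint k i hk h1 h
      · exact (hW a h).2.2 k h1
    by_cases h : j = i
    · subst h
      rw [Function.update_self] at ha
      rw [Function.update_of_ne hjk.symm] at hb
      exact key k hjk.symm hb ha
    · rw [Function.update_of_ne h] at ha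
      by_cases h' : k = i
      · subst h'
        rw [Function.update_self] at hb
        exact key j h ha hb
      · rw [Function.update_of_ne h'] at hb
        exact hA.disjoint j k hjk ha hb
  · by_cases h : j = i
    · subst h
      rw [Function.update_self, hmem]
      rintro (h | h)
      exacts [hA.left_notMem j h, (hW x h).1 rfl]
    · rw [Function.update_of_ne h]; exact hA.left_notMem j
  · by_cases h : j = i
    · subst h
      rw [Function.update_self, hmem]
      rintro (h | h)
      exacts [hA.right_notMem j h, (hW y h).2.1 rfl]
    · rw [Function.update_of_ne h]; exact hA.right_notMem j
  · refine Finset.sum_lt_sum (fun j _ => ?_) ⟨i, Finset.mem_univ i, ?_⟩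
    · by_cases h : j = i
      · subst h
        rw [Function.update_self, hB.length_eq]
        simp
      · rw [Function.update_of_ne h]
    · rw [Function.update_self, hB.length_eq]
      simpa using List.length_pos_iff.2 hne

/-- No walk through missed vertices leads from a path of the system forward to the same path. -/
def NoEar (r : V → V → Prop) (x y : V) (A : Fin 3 → List V) : Prop :=
  ∀ i u v a b, [u, v].Sublist (x :: (A i ++ [y])) → a ∈ missed x y A → r u a →
    ReachIn r (missed x y A) a b → r b v → False

theorem IsPathSystem.noEar (ht : ∀ u v, r u v ∨ r v u) {x y : V} {A : Fin 3 → List V}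
    (hA : IsPathSystem r x y A)
    (hmax : ∀ A', IsPathSystem r x y A' → ∑ i, (A' i).length ≤ ∑ i, (A i).length) :
    NoEar r x y A := by
  intro i u v a b huv ha hua hab hbv
  obtain ⟨l, hl, hn, hW, hlast⟩ := hab.exists_path ha
  obtain ⟨A', hA', hlt⟩ := hA.exists_extend ht (e := a :: l) huv (by
    rw [List.cons_append, List.isChain_cons_cons, ← List.cons_append, List.isChain_append]
    refine ⟨hua, hl, by simp, fun c hc d hd => ?_⟩
    rw [hlast] at hc
    simp only [Option.mem_def, Option.some.injEq, List.head?_cons] at hc hd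
    rw [← hc, ← hd]
    exact hbv) hn (by simp) hW
  exact absurd (hmax A' hA') (by omega)

theorem IsPathSystem.exists_max [Finite V] {x y : V}
    (h : ∃ A, IsPathSystem r x y A) :
    ∃ A, IsPathSystem r x y A ∧
      ∀ A', IsPathSystem r x y A' → ∑ i, (A' i).length ≤ ∑ i, (A i).length := by
  have := Fintype.ofFinite V
  refine exists_max_of_bounded (fun A => ∑ i, (A i).length) (3 * Fintype.card V) ?_ h
  intro A hA
  have : ∀ i ∈ Finset.univ, (A i).length ≤ Fintype.card V :=
    fun i _ => (hA.nodup i).length_le_card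
  simpa using Finset.sum_le_card_nsmul Finset.univ _ _ this

/-- Otherwise `w` dominates the last inner vertex, and `u`, `w`, that vertex form an ear. Hence an
arc from any inner vertex to `w` may be replaced by one from the last. -/
theorem IsPathSystem.rel_getLast (ht : ∀ u v, r u v ∨ r v u) {x y : V} {A : Fin 3 → List V}
    (hA : IsPathSystem r x y A) (hE : NoEar r x y A) {i : Fin 3} {u w : V} (hu : u ∈ A i)
    (hw : w ∈ missed x y A) (huw : r u w) : r ((A i).getLast (hA.ne_nil i)) w := by
  by_contra hcon
  have h1 := (ht ((A i).getLast (hA.ne_nil i)) w).resolve_left hcon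
  have h2 : A i = (A i).dropLast ++ [(A i).getLast (hA.ne_nil i)] :=
    (List.dropLast_append_getLast _).symm
  have h3 : u ∈ (A i).dropLast := by
    rw [h2, List.mem_append, List.mem_singleton] at hu
    rcases hu with hu | rfl
    · exact hu
    · exact absurd huw hcon
  refine hE i u _ w w ?_ hw huw .refl h1
  refine .cons _ (.trans ?_ (List.sublist_append_left _ _))
  exact ((List.singleton_sublist.2 h3).append (.refl [(A i).getLast (hA.ne_nil i)])).trans
    (h2 ▸ .refl _)

theorem IsPathSystem.rel_head (ht : ∀ u v, r u v ∨ r v u) {x y : V} {A : Fin 3 → List V}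
    (hA : IsPathSystem r x y A) (hE : NoEar r x y A) {i : Fin 3} {u w : V} (hu : u ∈ A i)
    (hw : w ∈ missed x y A) (hwu : r w u) : r w ((A i).head (hA.ne_nil i)) := by
  by_contra hcon
  have h1 := (ht w ((A i).head (hA.ne_nil i))).resolve_left hcon
  have h2 : A i = (A i).head (hA.ne_nil i) :: (A i).tail := (List.cons_head_tail _).symm
  have h3 : u ∈ (A i).tail := by
    rw [h2, List.mem_cons] at hu
    rcases hu with rfl | hu
    · exact absurd hwu hcon
    · exact hu
  refine hE i _ u w w ?_ hw h1 .refl hwu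
  refine .cons _ (.trans ?_ (List.sublist_append_left _ _))
  exact ((List.singleton_sublist.2 h3).cons_cons _).trans (h2 ▸ .refl _)

theorem exists_third {i j : Fin 3} (h : i ≠ j) :
    ∃ k, k ≠ i ∧ k ≠ j ∧ ∀ l, l = i ∨ l = j ∨ l = k := by
  revert i j; decide

theorem IsPathSystem.nodup_and_forall_mem {x y : V} (hxy : x ≠ y) {A : Fin 3 → List V}
    (hA : IsPathSystem r x y A) {i j k : Fin 3} (hij : i ≠ j) (hki : k ≠ i) (hkj : k ≠ j)
    (hk : ∀ l, l = i ∨ l = j ∨ l = k) {l : List V} (hn : l.Nodup)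
    (hl : ∀ z, z ∈ l ↔ z ∈ missed x y A) :
    (x :: y :: (A i ++ (A j ++ (A k ++ l)))).Nodup ∧
      ∀ v, v ∈ x :: y :: (A i ++ (A j ++ (A k ++ l))) := by
  have hd : ∀ i, (A i).Disjoint l := fun i a ha hb => ((hl a).1 hb).2.2 i ha
  have hx : x ∉ l := fun h => ((hl x).1 h).1 rfl
  have hy : y ∉ l := fun h => ((hl y).1 h).2.1 rfl
  constructor
  · simp only [List.nodup_cons, List.mem_cons, List.mem_append, not_or, List.nodup_append',
      List.disjoint_append_right]
    exact ⟨⟨hxy, hA.left_notMem i, hA.left_notMem j, hA.left_notMem k, hx⟩,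
      ⟨hA.right_notMem i, hA.right_notMem j, hA.right_notMem k, hy⟩, hA.nodup i,
      ⟨hA.nodup j, ⟨hA.nodup k, hn, hd k⟩, hA.disjoint j k hkj.symm, hd j⟩,
      hA.disjoint i j hij, hA.disjoint i k hki.symm, hd i⟩
  · intro v
    by_cases hv : v ∈ missed x y A
    · simp [(hl v).2 hv]
    · by_contra hcon
      simp only [List.mem_cons, List.mem_append, not_or] at hcon
      refine hv ⟨hcon.1, hcon.2.1, fun m => ?_⟩
      rcases hk m with rfl | rfl | rfl
      exacts [hcon.2.2.1, hcon.2.2.2.1, hcon.2.2.2.2.1]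

/-- The Hamiltonian path of the missed set links `A i` to `A j` in one `(x,y)`-chain. The third path
is an ear of it from `x` to `y` and is absorbed. -/
theorem IsPathSystem.hasHamPath_of_twist (ht : ∀ u v, r u v ∨ r v u) {x y : V} (hxy : x ≠ y)
    {A : Fin 3 → List V} (hA : IsPathSystem r x y A) {i j : Fin 3} (hij : i ≠ j) {s s' : V}
    (hi : r ((A i).getLast (hA.ne_nil i)) s') (hj : r s ((A j).head (hA.ne_nil j)))
    (h : HamSucc r (missed x y A) s s') : HasHamPath r x y := by
  obtain ⟨l, hl, hn, hW, hh, hlast⟩ := h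
  obtain ⟨k, hki, hkj, hk⟩ := exists_third hij
  have hQ : (x :: (A i ++ (l ++ (A j ++ [y])))).IsChain r := by
    rw [← List.cons_append]
    refine List.IsChain.append ((hA.chain i).prefix ⟨[y], by simp⟩)
      (List.IsChain.append hl ((hA.chain j).suffix ⟨[x], by simp⟩) ?_) ?_
    · intro a ha b hb
      rw [hlast] at ha
      rw [List.head?_append_of_ne_nil _ (hA.ne_nil j), List.head?_eq_some_head (hA.ne_nil j)] at hb
      simp only [Option.mem_def, Option.some.injEq] at ha hb
      rwa [← ha, ← hb]
    · intro a ha b hb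
      rw [List.getLast?_cons, List.getLast?_eq_some_getLast (hA.ne_nil i)] at ha
      rw [List.head?_append, hh] at hb
      simp at ha hb
      rwa [← ha, ← hb]
  obtain ⟨Q, hQc, hp, hQh, hQl, -⟩ := exists_absorb ht hQ (u := x) (v := y) (e := A k)
    (by simp) (hA.chain k)
  obtain ⟨hn', hall⟩ := hA.nodup_and_forall_mem hxy hij hki hkj hk hn hW
  have hp' : Q.Perm (x :: y :: (A i ++ (A j ++ (A k ++ l)))) := by
    classical
    refine hp.trans (List.perm_iff_count.2 fun a => ?_)
    simp only [List.cons_append, List.count_cons, List.count_append, List.count_nil]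
    omega
  refine ⟨Q, hQc, hp'.nodup_iff.2 hn', fun v => hp'.mem_iff.2 (hall v), by rw [hQh]; simp, ?_⟩
  rw [hQl, ← List.cons_append, ← List.append_assoc, ← List.append_assoc]
  exact List.getLast?_concat

/-! ### Initial and terminal components of the missed set -/

/-- The digraph with arc relation `r` is strong after deleting `z`, in terms of cuts. -/
def StrongWithout (r : V → V → Prop) (z : V) : Prop :=
  ∀ S : Set V, (∃ a ∈ S, a ≠ z) → (∃ b, b ∉ S ∧ b ≠ z) →
    ∃ u ∈ S, ∃ v, v ∉ S ∧ u ≠ z ∧ v ≠ z ∧ r u v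

/-- The vertices of `S` that reach all of `S`. -/
def sources (r : V → V → Prop) (S : Set V) : Set V := {a | a ∈ S ∧ ∀ z ∈ S, ReachIn r S a z}

/-- The vertices of `S` that are reached from all of `S`. -/
def sinks (r : V → V → Prop) (S : Set V) : Set V := {b | b ∈ S ∧ ∀ z ∈ S, ReachIn r S z b}

theorem reachIn_of_isChain {S : Set V} {a : V} {l : List V} (hl : (a :: l).IsChain r)
    (hS : ∀ z ∈ l, z ∈ S) {z : V} (hz : z ∈ a :: l) : ReachIn r S a z := by
  induction l generalizing a with
  | nil => rw [List.mem_singleton] at hz; subst hz; exact .refl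
  | cons c l ih =>
    rw [List.isChain_cons_cons] at hl
    rcases List.mem_cons.1 hz with rfl | hz
    · exact .refl
    · exact .head ⟨hl.1, hS c (by simp)⟩ (ih hl.2 (fun w hw => hS w (by simp [hw])) hz)

theorem exists_hamiltonian_chain [Finite V] (ht : ∀ u v, r u v ∨ r v u) (S : Set V) :
    ∃ m : List V, m.IsChain r ∧ m.Nodup ∧ ∀ z, z ∈ m ↔ z ∈ S := by
  obtain ⟨m, hm, hp⟩ := exists_chain_perm ht S.toFinite.toFinset.toList
  exact ⟨m, hm, hp.nodup_iff.2 (Finset.nodup_toList _), fun z => hp.mem_iff.trans (by simp)⟩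

theorem sources_nonempty [Finite V] (ht : ∀ u v, r u v ∨ r v u) {S : Set V} (hS : S.Nonempty) :
    (sources r S).Nonempty := by
  obtain ⟨m, hm, -, hmem⟩ := exists_hamiltonian_chain ht S
  cases m with
  | nil => obtain ⟨a, ha⟩ := hS; simpa using (hmem a).2 ha
  | cons a m =>
    exact ⟨a, (hmem a).1 (by simp), fun z hz =>
      reachIn_of_isChain hm (fun w hw => (hmem w).1 (by simp [hw])) ((hmem z).2 hz)⟩

theorem sinks_nonempty [Finite V] (ht : ∀ u v, r u v ∨ r v u) {S : Set V} (hS : S.Nonempty) :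
    (sinks r S).Nonempty := by
  obtain ⟨m, hm, -, hmem⟩ := exists_hamiltonian_chain ht S
  rcases List.eq_nil_or_concat' m with rfl | ⟨m, b, rfl⟩
  · obtain ⟨a, ha⟩ := hS; simpa using (hmem a).2 ha
  · refine ⟨b, (hmem b).1 (by simp), fun z hz => ?_⟩
    obtain ⟨p, s, hps⟩ := List.append_of_mem ((hmem z).2 hz)
    have hb : b ∈ z :: s := by
      have := congrArg List.getLast? hps
      rw [List.getLast?_concat, List.getLast?_append_of_ne_nil _ (by simp)] at this
      exact List.mem_of_getLast? this.symm
    rw [hps] at hm hmem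
    exact reachIn_of_isChain hm.right_of_append (fun w hw => (hmem w).1 (by simp [hw])) hb

theorem mem_sources_of_reachIn {S : Set V} {a b : V} (ha : a ∈ S) (hab : ReachIn r S a b)
    (hb : b ∈ sources r S) : a ∈ sources r S :=
  ⟨ha, fun z hz => hab.trans (hb.2 z hz)⟩

theorem mem_sinks_of_reachIn {S : Set V} {a b : V} (ha : a ∈ sinks r S)
    (hab : ReachIn r S a b) : b ∈ sinks r S :=
  ⟨hab.mem ha.1, fun z hz => (ha.2 z hz).trans hab⟩

/-- A walk in `S` from a source to a source never leaves the sources, since each vertex on it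
reaches its end. -/
theorem exists_hamiltonian_sources [Finite V] (ht : ∀ u v, r u v ∨ r v u) {S : Set V} {a : V}
    (ha : a ∈ sources r S) : ∃ l : List V, (a :: l).IsChain r ∧ (a :: l).Nodup ∧
      ∀ z, z ∈ a :: l ↔ z ∈ sources r S := by
  refine exists_hamiltonian_from ht ha fun z hz => ?_
  have h := ha.2 z hz.1
  clear ha
  induction h using Relation.ReflTransGen.head_induction_on with
  | refl => exact .refl
  | head hac hcz ih => exact .head ⟨hac.1, mem_sources_of_reachIn hac.2 hcz hz⟩ ih

theorem exists_hamiltonian_sinks [Finite V] (ht : ∀ u v, r u v ∨ r v u) {S : Set V} {b : V}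
    (hb : b ∈ sinks r S) : ∃ l : List V, (l ++ [b]).IsChain r ∧ (l ++ [b]).Nodup ∧
      ∀ z, z ∈ l ++ [b] ↔ z ∈ sinks r S := by
  obtain ⟨l, hl, hn, hmem⟩ := exists_hamiltonian_from (r := fun u v => r v u) (a := b)
    (S := sinks r S) (fun u v => (ht u v).symm) hb (by
      intro z hz
      have h := hb.2 z hz.1
      revert hz
      induction h using Relation.ReflTransGen.head_induction_on with
      | refl => exact fun _ => .refl
      | head hac hcz ih =>
        exact fun hz => .tail (ih (mem_sinks_of_reachIn hz (.single hac))) ⟨hac.1, hz⟩)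
  have h : l.reverse ++ [b] = (b :: l).reverse := by simp
  refine ⟨l.reverse, ?_, ?_, fun z => ?_⟩
  · rw [h, List.isChain_reverse]; exact hl
  · rw [h, List.nodup_reverse]; exact hn
  · rw [h, List.mem_reverse]; exact hmem z

theorem rel_of_mem_sources (ht : ∀ u v, r u v ∨ r v u) {S : Set V} {a z : V}
    (ha : a ∈ sources r S) (hz : z ∈ S) (hz' : z ∉ sources r S) : r a z :=
  (ht a z).resolve_right fun h => hz' (mem_sources_of_reachIn hz (.single ⟨h, ha.1⟩) ha)

theorem rel_of_mem_sinks (ht : ∀ u v, r u v ∨ r v u) {S : Set V} {b z : V}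
    (hb : b ∈ sinks r S) (hz : z ∈ S) (hz' : z ∉ sinks r S) : r z b :=
  (ht z b).resolve_right fun h => hz' (mem_sinks_of_reachIn hb (.single ⟨h, hz⟩))

variable {x y : V} {A : Fin 3 → List V}

theorem mem_of_notMem_missed {v : V} (hv : v ∉ missed x y A) :
    v = x ∨ v = y ∨ ∃ i, v ∈ A i := by
  by_contra hcon
  push Not at hcon
  exact hv hcon

/-- From `w` every sink is reached. With `x` deleted, some arc still leaves the set of sinks, and
its head is not missed. That head comes after `x` on one of the paths, which closes an ear. -/
theorem NoEar.not_rel_left [Finite V] (ht : ∀ u v, r u v ∨ r v u) (hxy : x ≠ y)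
    (hx : StrongWithout r x) (hE : NoEar r x y A) {w : V}
    (hw : w ∈ missed x y A) : ¬ r x w := by
  intro hxw
  obtain ⟨b₀, hb₀⟩ := sinks_nonempty ht ⟨w, hw⟩
  obtain ⟨b, hb, v, hv, -, hvx, hbv⟩ := hx (sinks r (missed x y A)) ⟨b₀, hb₀, hb₀.1.1⟩
    ⟨y, fun h => h.1.2.1 rfl, hxy.symm⟩
  have hvW : v ∉ missed x y A := fun h => hv (mem_sinks_of_reachIn hb (.single ⟨hbv, h⟩))
  rcases mem_of_notMem_missed hvW with h | rfl | ⟨i, hi⟩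
  · exact hvx h
  · exact hE 0 x v w b (by simp) hw hxw (hb.2 w hw) hbv
  · exact hE i x v w b (by simp [hi]) hw hxw (hb.2 w hw) hbv

theorem NoEar.not_rel_right [Finite V] (ht : ∀ u v, r u v ∨ r v u) (hxy : x ≠ y)
    (hy : StrongWithout r y) (hE : NoEar r x y A) {w : V}
    (hw : w ∈ missed x y A) : ¬ r w y := by
  intro hwy
  obtain ⟨a₀, ha₀⟩ := sources_nonempty ht ⟨w, hw⟩
  obtain ⟨u, hu, a, ha, huy, -, hua⟩ := hy (sources r (missed x y A))ᶜ
    ⟨x, fun h => h.1.1 rfl, hxy⟩ ⟨a₀, fun h => h ha₀, ha₀.1.2.1⟩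
  rw [Set.mem_compl_iff, not_not] at ha
  have huW : u ∉ missed x y A := fun h => hu (mem_sources_of_reachIn h (.single ⟨hua, ha.1⟩) ha)
  have hsub : ∀ i, u ∈ A i → [u, y].Sublist (x :: (A i ++ [y])) := fun i hi =>
    .cons _ ((List.singleton_sublist.2 hi).append (.refl [y]))
  rcases mem_of_notMem_missed huW with rfl | h | ⟨i, hi⟩
  · exact hE 0 u y a w (by simp) ha.1 hua (ha.2 w hw) hwy
  · exact huy h
  · exact hE i u y a w (hsub i hi) ha.1 hua (ha.2 w hw) hwy

/-- With `y` deleted, some arc still enters the set of sources. Its tail is neither missed nor `x`,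
so it is an inner vertex, and `rel_getLast` applies. -/
theorem IsPathSystem.exists_rel_sources [Finite V] (ht : ∀ u v, r u v ∨ r v u) (hxy : x ≠ y)
    (hx : StrongWithout r x) (hy : StrongWithout r y) (hA : IsPathSystem r x y A)
    (hE : NoEar r x y A) (hW : (missed x y A).Nonempty) :
    ∃ i, ∃ a ∈ sources r (missed x y A), r ((A i).getLast (hA.ne_nil i)) a := by
  obtain ⟨a₀, ha₀⟩ := sources_nonempty ht hW
  obtain ⟨u, hu, a, ha, huy, -, hua⟩ := hy (sources r (missed x y A))ᶜ
    ⟨x, fun h => h.1.1 rfl, hxy⟩ ⟨a₀, fun h => h ha₀, ha₀.1.2.1⟩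
  rw [Set.mem_compl_iff, not_not] at ha
  have huW : u ∉ missed x y A := fun h => hu (mem_sources_of_reachIn h (.single ⟨hua, ha.1⟩) ha)
  rcases mem_of_notMem_missed huW with rfl | h | ⟨i, hi⟩
  · exact absurd hua (hE.not_rel_left ht hxy hx ha.1)
  · exact absurd h huy
  · exact ⟨i, a, ha, hA.rel_getLast ht hE hi ha.1 hua⟩

theorem IsPathSystem.exists_rel_sinks [Finite V] (ht : ∀ u v, r u v ∨ r v u) (hxy : x ≠ y)
    (hx : StrongWithout r x) (hy : StrongWithout r y) (hA : IsPathSystem r x y A)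
    (hE : NoEar r x y A) (hW : (missed x y A).Nonempty) :
    ∃ j, ∃ b ∈ sinks r (missed x y A), r b ((A j).head (hA.ne_nil j)) := by
  obtain ⟨b₀, hb₀⟩ := sinks_nonempty ht hW
  obtain ⟨b, hb, v, hv, -, hvx, hbv⟩ := hx (sinks r (missed x y A)) ⟨b₀, hb₀, hb₀.1.1⟩
    ⟨y, fun h => h.1.2.1 rfl, hxy.symm⟩
  have hvW : v ∉ missed x y A := fun h => hv (mem_sinks_of_reachIn hb (.single ⟨hbv, h⟩))
  rcases mem_of_notMem_missed hvW with h | rfl | ⟨j, hj⟩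
  · exact absurd h hvx
  · exact absurd hbv (hE.not_rel_right ht hxy hy hb.1)
  · exact ⟨j, b, hb, hA.rel_head ht hE hj hb.1 hbv⟩

theorem IsPathSystem.hasHamPath_of_missed_empty (ht : ∀ u v, r u v ∨ r v u) (hxy : x ≠ y)
    (hA : IsPathSystem r x y A) (hW : ¬ (missed x y A).Nonempty) : HasHamPath r x y := by
  obtain ⟨Q, hQ, hQp, hQh, hQl, hQs⟩ := exists_absorb ht (hA.chain 0) (u := x) (v := y) (e := A 1)
    (by simp) (hA.chain 1)
  obtain ⟨R, hR, hRp, hRh, hRl, -⟩ := exists_absorb ht hQ (u := x) (v := y) (e := A 2)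
    (.trans (by simp) hQs) (hA.chain 2)
  obtain ⟨hn, hall⟩ := hA.nodup_and_forall_mem hxy (i := 0) (j := 1) (k := 2) (by decide)
    (by decide) (by decide) (by decide) (l := []) (by simp)
    (fun z => ⟨fun h => by simp at h, fun h => absurd ⟨z, h⟩ hW⟩)
  have hp : R.Perm (x :: y :: (A 0 ++ (A 1 ++ (A 2 ++ [])))) := by
    classical
    refine (hRp.trans (hQp.append_right _)).trans (List.perm_iff_count.2 fun a => ?_)
    simp only [List.cons_append, List.count_cons, List.count_append, List.count_nil]
    omega
  refine ⟨R, hR, hp.nodup_iff.2 hn, fun v => hp.mem_iff.2 (hall v), by rw [hRh, hQh]; simp, ?_⟩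
  rw [hRl, hQl, ← List.cons_append]
  exact List.getLast?_concat

theorem exists_ne_both (i j : Fin 3) : ∃ k, k ≠ i ∧ k ≠ j := by
  revert i j; decide

/-! ### Missed set strong -/

/-- The case in which the missed vertices induce a strong digraph. -/
theorem IsPathSystem.hasHamPath_of_missed_strong [Finite V] (ht : ∀ u v, r u v ∨ r v u)
    (hxy : x ≠ y) (hx : StrongWithout r x) (hy : StrongWithout r y) (hA : IsPathSystem r x y A)
    (hE : NoEar r x y A) (hW : (missed x y A).Nonempty)
    (hs : ∀ a ∈ missed x y A, ∀ b ∈ missed x y A, ReachIn r (missed x y A) a b) :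
    HasHamPath r x y := by
  by_contra hcon
  obtain ⟨hsucc, hall⟩ := exists_hamSucc ht hW hs
  have hmem : ∀ {s s'}, HamSucc r (missed x y A) s s' → s' ∈ missed x y A := by
    rintro s s' ⟨l, -, -, hl, hh, -⟩
    exact (hl s').1 (List.mem_of_head? hh)
  have hno : ∀ {i j : Fin 3}, i ≠ j → ∀ {s s'}, HamSucc r (missed x y A) s s' →
      r s ((A j).head (hA.ne_nil j)) → ¬ r ((A i).getLast (hA.ne_nil i)) s' :=
    fun hij _ _ h hj hi => hcon (hA.hasHamPath_of_twist ht hxy hij hi hj h)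
  have hback : ∀ {i w}, w ∈ missed x y A → ¬ r ((A i).getLast (hA.ne_nil i)) w →
      r w ((A i).head (hA.ne_nil i)) := fun {i w} hw h =>
    hA.rel_head ht hE (List.getLast_mem (hA.ne_nil i)) hw ((ht _ _).resolve_left h)
  obtain ⟨j, w₀, hw₀, hj⟩ := hA.exists_rel_sinks ht hxy hx hy hE hW
  obtain ⟨i₀, a, ha, hi₀⟩ := hA.exists_rel_sources ht hxy hx hy hE hW
  obtain ⟨w₁, hw₁, h01⟩ := hsucc w₀ hw₀.1
  obtain ⟨w₂, hw₂, h12⟩ := hsucc w₁ hw₁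
  have h1 : ∀ i, i ≠ j → r w₁ ((A i).head (hA.ne_nil i)) := fun i hi =>
    hback hw₁ (hno hi h01 hj)
  -- Since `w₁` dominates the starts of both paths other than `A j`, every `A i` has a different
  -- path available for a twist.
  have h2 : ∀ i, ¬ r ((A i).getLast (hA.ne_nil i)) w₂ := by
    intro i
    obtain ⟨k, hki, hkj⟩ := exists_ne_both i j
    exact hno hki.symm h12 (h1 k hkj)
  -- If no path end dominates a vertex, that vertex dominates every path start, so no path end
  -- dominates its successor. This propagates round the cycle to `a`, which the end of `A i₀` does
  -- dominate.
  have h3 : ∀ w, Relation.ReflTransGen (HamSucc r (missed x y A)) w₂ w →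
      w ∈ missed x y A ∧ ∀ i, ¬ r ((A i).getLast (hA.ne_nil i)) w := by
    intro w hw
    induction hw with
    | refl => exact ⟨hw₂, h2⟩
    | tail _ hbc ih =>
      refine ⟨hmem hbc, fun i => ?_⟩
      obtain ⟨k, hki, -⟩ := exists_ne_both i i
      exact hno hki.symm hbc (hback ih.1 (ih.2 k))
  exact (h3 a (hall w₂ hw₂ a ha.1)).2 i₀ hi₀

/-! ### Missed set not strong -/

/-- For two nonempty lists `A j` and `A k`, every list of vertices splits into a part that
ends with an arc to one of them and a part that starts with an arc from the other. -/
theorem exists_split (ht : ∀ u v, r u v ∨ r v u) {A : Fin 3 → List V} {j k : Fin 3}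
    (hjk : j ≠ k) (hj : A j ≠ []) (hk : A k ≠ []) (m : List V) :
    ∃ α β : Fin 3, (α = j ∧ β = k ∨ α = k ∧ β = j) ∧ ∃ p s, m = p ++ s ∧
      (∀ c ∈ p.getLast?, ∃ v ∈ A β, r c v) ∧ (∀ c ∈ s.head?, ∃ u ∈ A α, r u c) := by
  induction m using List.reverseRecOn with
  | nil => exact ⟨j, k, .inl ⟨rfl, rfl⟩, [], [], by simp⟩
  | append_singleton m a ih =>
    by_cases h1 : ∃ v ∈ A k, r a v
    · exact ⟨j, k, .inl ⟨rfl, rfl⟩, m ++ [a], [], by simp, by simpa using h1, by simp⟩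
    by_cases h2 : ∃ v ∈ A j, r a v
    · exact ⟨k, j, .inr ⟨rfl, rfl⟩, m ++ [a], [], by simp, by simpa using h2, by simp⟩
    -- Now `a` dominates nothing in either list, so by totality both lists dominate `a`, and `a` can
    -- begin `s` for either choice of `α`.
    obtain ⟨α, β, hαβ, p, s, rfl, hp, hs⟩ := ih
    refine ⟨α, β, hαβ, p, s ++ [a], by simp, hp, fun c hc => ?_⟩
    cases s with
    | cons b s => exact hs c (by simpa using hc)
    | nil =>
      obtain rfl : a = c := by simpa using hc
      obtain ⟨u, hu⟩ := List.exists_mem_of_ne_nil _ hj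
      obtain ⟨v, hv⟩ := List.exists_mem_of_ne_nil _ hk
      rcases hαβ with ⟨rfl, -⟩ | ⟨rfl, -⟩
      · exact ⟨u, hu, (ht u a).resolve_right fun h => h2 ⟨u, hu, h⟩⟩
      · exact ⟨v, hv, (ht v a).resolve_right fun h => h1 ⟨v, hv, h⟩⟩

theorem exists_absorb_of_ne_nil (ht : ∀ u v, r u v ∨ r v u) {Q e : List V} (hQ : Q.IsChain r)
    (he : e ≠ [] → ∃ u v, [u, v].Sublist Q ∧ (u :: (e ++ [v])).IsChain r) :
    ∃ Q' : List V, Q'.IsChain r ∧ Q'.Perm (Q ++ e) ∧ Q'.head? = Q.head? ∧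
      Q'.getLast? = Q.getLast? ∧ Q.Sublist Q' := by
  by_cases h : e = []
  · subst h; exact ⟨Q, hQ, by simp, rfl, rfl, .refl _⟩
  · obtain ⟨u, v, h1, h2⟩ := he h
    exact exists_absorb ht hQ h1 h2

theorem isChain_between {e : List V} {u v : V} (he : e.IsChain r) (hne : e ≠ [])
    (hu : ∀ c ∈ e.head?, r u c) (hv : ∀ c ∈ e.getLast?, r c v) : (u :: (e ++ [v])).IsChain r := by
  refine List.IsChain.cons (he.append (by simp) fun c hc d hd => ?_) fun c hc => ?_
  · obtain rfl : v = d := by simpa using hd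
    exact hv c hc
  · rw [List.head?_append_of_ne_nil _ hne] at hc
    exact hu c hc

/-- The backbone is `x`, `A α`, sinks, `A i`, sources, `A β`, `y`. The remaining missed vertices are
two ears of it: `p` from `a` to `A β`, and `s` from `A α` to `b`. -/
theorem IsPathSystem.hasHamPath_of_interleave (ht : ∀ u v, r u v ∨ r v u) (hxy : x ≠ y)
    (hA : IsPathSystem r x y A) {i α β : Fin 3} (hαi : α ≠ i) (hβi : β ≠ i) (hαβ : α ≠ β)
    (hcover : ∀ l, l = α ∨ l = i ∨ l = β) {a b : V} {l k p s : List V}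
    (hl : (a :: l).IsChain r) (hk : (k ++ [b]).IsChain r) (hps : (p ++ s).IsChain r)
    (hn : (a :: l ++ (p ++ s ++ (k ++ [b]))).Nodup)
    (hW : ∀ z, z ∈ a :: l ++ (p ++ s ++ (k ++ [b])) ↔ z ∈ missed x y A)
    (hia : r ((A i).getLast (hA.ne_nil i)) a) (hbi : r b ((A i).head (hA.ne_nil i)))
    (hβ : ∀ c ∈ a :: l, ∀ v ∈ A β, r c v) (hα : ∀ c ∈ k ++ [b], ∀ u ∈ A α, r u c)
    (hlm : ∀ c ∈ a :: l, ∀ z ∈ p ++ s, r c z) (hmk : ∀ c ∈ k ++ [b], ∀ z ∈ p ++ s, r z c)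
    (hp : ∀ c ∈ p.getLast?, ∃ v ∈ A β, r c v) (hs : ∀ c ∈ s.head?, ∃ u ∈ A α, r u c) :
    HasHamPath r x y := by
  have hQ : (x :: (A α ++ ((k ++ [b]) ++ (A i ++ (a :: l ++ (A β ++ [y])))))).IsChain r := by
    rw [← List.cons_append]
    refine List.IsChain.append ((hA.chain α).prefix ⟨[y], by simp⟩) (hk.append
      (List.IsChain.append ((hA.chain i).infix ⟨[x], [y], by simp⟩)
        (hl.append ((hA.chain β).suffix ⟨[x], by simp⟩) ?_) ?_) ?_) ?_
    · intro c hc d hd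
      rw [List.head?_append_of_ne_nil _ (hA.ne_nil β)] at hd
      exact hβ c (List.mem_of_getLast? hc) d (List.mem_of_head? hd)
    · intro c hc d hd
      rw [List.getLast?_eq_some_getLast (hA.ne_nil i)] at hc
      simp only [List.cons_append, List.head?_cons, Option.mem_def, Option.some.injEq] at hc hd
      rwa [← hc, ← hd]
    · intro c hc d hd
      rw [List.getLast?_concat] at hc
      rw [List.head?_append_of_ne_nil _ (hA.ne_nil i), List.head?_eq_some_head (hA.ne_nil i)] at hd
      simp only [Option.mem_def, Option.some.injEq] at hc hd
      rwa [← hc, ← hd]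
    · intro c hc d hd
      rw [List.getLast?_cons, List.getLast?_eq_some_getLast (hA.ne_nil α)] at hc
      rw [List.head?_append_of_ne_nil _ (by simp)] at hd
      simp only [Option.getD_some, Option.mem_def, Option.some.injEq] at hc
      rw [← hc]
      exact hα d (List.mem_of_head? hd) _ (List.getLast_mem _)
  obtain ⟨Q, hQc, hQp, hQh, hQl, hQs⟩ := exists_absorb_of_ne_nil ht hQ (e := p) (by
    intro hne
    obtain ⟨v, hv, hcv⟩ := hp _ (List.getLast?_eq_some_getLast hne)
    refine ⟨a, v, ?_, isChain_between hps.left_of_append hne (fun c hc => ?_) fun c hc => ?_⟩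
    · refine .cons _ (.trans (.trans ?_ (List.sublist_append_right _ _))
        ((List.sublist_append_right _ _).trans (List.sublist_append_right _ _)))
      have h1 : [a].Sublist (a :: l) := by simp
      have h2 : [v].Sublist (A β ++ [y]) := by simp [hv]
      exact h1.append h2
    · exact hlm a (by simp) c (List.mem_append_left _ (List.mem_of_head? hc))
    · rw [List.getLast?_eq_some_getLast hne] at hc
      simp only [Option.mem_def, Option.some.injEq] at hc
      rwa [← hc])
  obtain ⟨R, hR, hRp, hRh, hRl, -⟩ := exists_absorb_of_ne_nil ht hQc (e := s) (by
    intro hne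
    obtain ⟨u, hu, huc⟩ := hs _ (List.head?_eq_some_head hne)
    refine ⟨u, b, .trans ?_ hQs, isChain_between hps.right_of_append hne
      (fun c hc => ?_) fun c hc => ?_⟩
    · refine .cons _ ?_
      have h1 : [u].Sublist (A α) := by simpa using hu
      have h2 : [b].Sublist ((k ++ [b]) ++ (A i ++ (a :: l ++ (A β ++ [y])))) := by simp
      exact h1.append h2
    · rw [List.head?_eq_some_head hne] at hc
      simp only [Option.mem_def, Option.some.injEq] at hc
      rwa [← hc]
    · exact hmk b (by simp) c (List.mem_append_right _ (List.mem_of_getLast? hc)))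
  obtain ⟨hn', hall⟩ := hA.nodup_and_forall_mem hxy hαi hαβ.symm hβi hcover hn hW
  have hp' : R.Perm (x :: y :: (A α ++ (A i ++ (A β ++ (a :: l ++ (p ++ s ++ (k ++ [b]))))))) := by
    classical
    refine (hRp.trans (hQp.append_right _)).trans (List.perm_iff_count.2 fun a => ?_)
    simp only [List.cons_append, List.count_cons, List.count_append, List.count_nil]
    omega
  refine ⟨R, hR, hp'.nodup_iff.2 hn', fun v => hp'.mem_iff.2 (hall v),
    by rw [hRh, hQh]; simp, ?_⟩
  rw [hRl, hQl]
  simp only [← List.append_assoc, ← List.cons_append]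
  exact List.getLast?_concat

/-- A non-strong set has a Hamiltonian path from any source to any sink, passing through the
sources first and the sinks last. -/
theorem exists_hamiltonian_source_sink [Finite V] (ht : ∀ u v, r u v ∨ r v u) {W : Set V}
    (hs : ∀ c ∈ sources r W, c ∉ sinks r W) {a b : V}
    (ha : a ∈ sources r W) (hb : b ∈ sinks r W) :
    ∃ l m k : List V, (a :: l).IsChain r ∧ m.IsChain r ∧ (k ++ [b]).IsChain r ∧
      (a :: l ++ (m ++ (k ++ [b]))).Nodup ∧ (∀ z, z ∈ a :: l ++ (m ++ (k ++ [b])) ↔ z ∈ W) ∧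
      (∀ z, z ∈ a :: l ↔ z ∈ sources r W) ∧ (∀ z, z ∈ k ++ [b] ↔ z ∈ sinks r W) ∧
      (∀ c ∈ a :: l, ∀ z ∈ m, r c z) ∧ (∀ c ∈ k ++ [b], ∀ z ∈ m, r z c) ∧
      (∀ c ∈ a :: l, ∀ z ∈ k ++ [b], r c z) := by
  obtain ⟨l, hl, hln, hlmem⟩ := exists_hamiltonian_sources ht ha
  obtain ⟨k, hk, hkn, hkmem⟩ := exists_hamiltonian_sinks ht hb
  obtain ⟨m, hm, hmn, hmmem⟩ :=
    exists_hamiltonian_chain ht {z | z ∈ W ∧ z ∉ sources r W ∧ z ∉ sinks r W}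
  refine ⟨l, m, k, hl, hm, hk, ?_, ?_, hlmem, hkmem, ?_, ?_, ?_⟩
  · refine List.nodup_append'.2 ⟨hln, List.nodup_append'.2 ⟨hmn, hkn, ?_⟩, ?_⟩
    · exact fun z hz hz' => ((hmmem z).1 hz).2.2 ((hkmem z).1 hz')
    · intro z hz hz'
      rcases List.mem_append.1 hz' with h | h
      · exact ((hmmem z).1 h).2.1 ((hlmem z).1 hz)
      · exact hs z ((hlmem z).1 hz) ((hkmem z).1 h)
  · intro z
    rw [List.mem_append, List.mem_append, hlmem, hkmem, hmmem]
    refine ⟨?_, fun hz => ?_⟩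
    · rintro (h | h | h)
      exacts [h.1, h.1, h.1]
    · by_cases h1 : z ∈ sources r W
      · exact .inl h1
      · by_cases h2 : z ∈ sinks r W
        · exact .inr (.inr h2)
        · exact .inr (.inl ⟨hz, h1, h2⟩)
  · exact fun c hc z hz =>
      rel_of_mem_sources ht ((hlmem c).1 hc) ((hmmem z).1 hz).1 ((hmmem z).1 hz).2.1
  · exact fun c hc z hz =>
      rel_of_mem_sinks ht ((hkmem c).1 hc) ((hmmem z).1 hz).1 ((hmmem z).1 hz).2.2
  · exact fun c hc z hz =>
      rel_of_mem_sinks ht ((hkmem z).1 hz) ((hlmem c).1 hc).1 (hs c ((hlmem c).1 hc))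

theorem hamSucc_of_source_sink [Finite V] (ht : ∀ u v, r u v ∨ r v u) {W : Set V}
    (hs : ∀ c ∈ sources r W, c ∉ sinks r W) {a b : V}
    (ha : a ∈ sources r W) (hb : b ∈ sinks r W) : HamSucc r W b a := by
  obtain ⟨l, m, k, hl, hm, hk, hn, hmem, -, -, hlm, hmk, hlk⟩ :=
    exists_hamiltonian_source_sink ht hs ha hb
  refine ⟨_, hl.append (hm.append hk fun c hc d hd => ?_) fun c hc d hd => ?_, hn, hmem,
    by simp, ?_⟩
  · exact hmk d (List.mem_of_head? hd) c (List.mem_of_getLast? hc)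
  · rcases List.mem_append.1 (List.mem_of_head? hd) with h | h
    exacts [hlm c (List.mem_of_getLast? hc) d h, hlk c (List.mem_of_getLast? hc) d h]
  · rw [← List.append_assoc, ← List.append_assoc]
    exact List.getLast?_concat

/-- The case in which the missed vertices induce a digraph that is not strong. -/
theorem IsPathSystem.hasHamPath_of_missed_not_strong [Finite V] (ht : ∀ u v, r u v ∨ r v u)
    (hxy : x ≠ y) (hx : StrongWithout r x) (hy : StrongWithout r y) (hA : IsPathSystem r x y A)
    (hE : NoEar r x y A) (hW : (missed x y A).Nonempty)
    (hs : ∀ c ∈ sources r (missed x y A), c ∉ sinks r (missed x y A)) :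
    HasHamPath r x y := by
  by_contra hcon
  obtain ⟨i, a, ha, hia⟩ := hA.exists_rel_sources ht hxy hx hy hE hW
  obtain ⟨j, b, hb, hbj⟩ := hA.exists_rel_sinks ht hxy hx hy hE hW
  have twist : ∀ {i j : Fin 3} {a b : V}, i ≠ j → a ∈ sources r (missed x y A) →
      b ∈ sinks r (missed x y A) → r ((A i).getLast (hA.ne_nil i)) a →
      r b ((A j).head (hA.ne_nil j)) → False := fun hij ha hb hia hbj =>
    hcon (hA.hasHamPath_of_twist ht hxy hij hia hbj (hamSucc_of_source_sink ht hs ha hb))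
  -- Entering the sources and leaving the sinks along different paths would be a twist, so a single
  -- path `A i` does both.
  obtain rfl : i = j := by
    by_contra hij
    exact twist hij ha hb hia hbj
  -- An arc from `A k` to a source would give a twist with the arc from `b` to the start of `A i`;
  -- totality reverses it. Dually for sinks.
  have hout : ∀ k, k ≠ i → ∀ c ∈ sources r (missed x y A), ∀ v ∈ A k, r c v :=
    fun k hk c hc v hv => (ht c v).resolve_right fun h =>
      twist hk hc hb (hA.rel_getLast ht hE hv hc.1 h) hbj
  have hin : ∀ k, k ≠ i → ∀ c ∈ sinks r (missed x y A), ∀ u ∈ A k, r u c :=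
    fun k hk c hc u hu => (ht u c).resolve_right fun h =>
      twist hk.symm ha hc hia (hA.rel_head ht hE hu hc.1 h)
  obtain ⟨l, m, k, hl, hm, hk, hn, hmem, hlmem, hkmem, hlm, hmk, -⟩ :=
    exists_hamiltonian_source_sink ht hs ha hb
  obtain ⟨j₁, hj₁, -⟩ := exists_ne_both i i
  obtain ⟨j₂, hj₂, hj₂₁, hcover⟩ := exists_third hj₁.symm
  obtain ⟨α, β, hαβ, p, s, rfl, hp, hs'⟩ :=
    exists_split ht hj₂₁.symm (hA.ne_nil j₁) (hA.ne_nil j₂) m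
  have h0 : α ≠ i ∧ β ≠ i ∧ α ≠ β ∧ ∀ l, l = α ∨ l = i ∨ l = β := by
    rcases hαβ with ⟨rfl, rfl⟩ | ⟨rfl, rfl⟩
    · exact ⟨hj₁, hj₂, hj₂₁.symm, fun l => by rcases hcover l with h | h | h <;> simp [h]⟩
    · exact ⟨hj₂, hj₁, hj₂₁, fun l => by rcases hcover l with h | h | h <;> simp [h]⟩
  obtain ⟨hαi, hβi, hne, hcov⟩ := h0
  exact hcon (hA.hasHamPath_of_interleave ht hxy hαi hβi hne hcov hl hk hm hn hmem hia hbj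
    (fun c hc => hout β hβi c ((hlmem c).1 hc)) (fun c hc => hin α hαi c ((hkmem c).1 hc))
    hlm hmk hp hs')

/-- Thomassen's theorem: three internally disjoint `(x,y)`-paths with inner vertices yield
a Hamiltonian `(x,y)`-path. -/
theorem hasHamPath_of_pathSystem [Finite V] (ht : ∀ u v, r u v ∨ r v u)
    (hxy : x ≠ y) (hx : StrongWithout r x) (hy : StrongWithout r y)
    (h : ∃ A, IsPathSystem r x y A) : HasHamPath r x y := by
  obtain ⟨A, hA, hmax⟩ := IsPathSystem.exists_max h
  have hE := hA.noEar ht hmax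
  by_cases hW : (missed x y A).Nonempty
  · by_cases hs : ∀ c ∈ sources r (missed x y A), c ∉ sinks r (missed x y A)
    · exact hA.hasHamPath_of_missed_not_strong ht hxy hx hy hE hW hs
    · push Not at hs
      obtain ⟨c, hc, hc'⟩ := hs
      exact hA.hasHamPath_of_missed_strong ht hxy hx hy hE hW fun a ha b hb =>
        (hc'.2 a ha).trans (hc.2 b hb)
  · exact hA.hasHamPath_of_missed_empty ht hxy hW

/-! ### Three disjoint paths from Hall's theorem -/

/-- The digraph with arc relation `r` stays strong after deleting fewer than `k` vertices, in terms
of cuts. -/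
def StrongWithoutFew (r : V → V → Prop) (k : ℕ) : Prop :=
  ∀ X : Finset V, X.card < k → ∀ S : Set V, (∃ a ∈ S, a ∉ X) → (∃ b, b ∉ S ∧ b ∉ X) →
    ∃ u ∈ S, ∃ v, v ∉ S ∧ u ∉ X ∧ v ∉ X ∧ r u v

theorem StrongWithoutFew.strongWithout {k : ℕ} (h : StrongWithoutFew r k) (hk : 1 < k) (z : V) :
    StrongWithout r z := by
  intro S ha hb
  simpa using h {z} (by simpa using hk) S (by simpa using ha) (by simpa using hb)

/-- The incidence relation whose perfect matchings are systems of three disjoint paths: three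
copies of `x` on the left, three copies of `y` on the right, and a vertex matched to
itself is unused. -/
def LinkRel (r : V → V → Prop) (x y : V) : Fin 3 ⊕ V → V ⊕ Fin 3 → Prop
  | .inl _, .inl t => t ≠ x ∧ t ≠ y ∧ r x t
  | .inl _, .inr _ => False
  | .inr u, .inl t => u = t ∨ u ≠ x ∧ u ≠ y ∧ t ≠ x ∧ t ≠ y ∧ r u t
  | .inr u, .inr _ => u ≠ x ∧ u ≠ y ∧ r u y

/-- Hall's condition for `U` is immediate if `U` has no copy of `x` (match vertices to themselves)
or reaches `y` (all three copies of `y` are gained). Otherwise the outside neighbours `T` separate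
`x` from `y` apart from a direct arc, and connectivity forces at least three of them. -/
theorem exists_linkage [Finite V] (hV : 5 ≤ Nat.card V) (hr : StrongWithoutFew r 4)
    (hxy : x ≠ y) :
    ∃ f : Fin 3 ⊕ V → V ⊕ Fin 3, Function.Injective f ∧ ∀ p, LinkRel r x y p (f p) := by
  classical
  have := Fintype.ofFinite V
  refine (Fintype.all_card_le_filter_rel_iff_exists_injective (LinkRel r x y)).1 fun U => ?_
  have hcard : U.card = U.toLeft.card + U.toRight.card :=
    (Finset.card_toLeft_add_card_toRight).symm
  have h3 : U.toLeft.card ≤ 3 := by simpa using Finset.card_le_univ U.toLeft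
  rcases U.toLeft.eq_empty_or_nonempty with h0 | ⟨i, hi⟩
  · rw [hcard, h0, Finset.card_empty, zero_add,
      ← Finset.card_map Function.Embedding.inl (β := V ⊕ Fin 3)]
    refine Finset.card_le_card fun t ht => ?_
    obtain ⟨u, hu, rfl⟩ := Finset.mem_map.1 ht
    exact Finset.mem_filter.2 ⟨Finset.mem_univ _, .inr u, Finset.mem_toRight.1 hu, .inl rfl⟩
  have hi' : .inl i ∈ U := Finset.mem_toLeft.1 hi
  by_cases hy : ∃ u ∈ U.toRight, u ≠ x ∧ u ≠ y ∧ r u y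
  · obtain ⟨u, hu, hu'⟩ := hy
    have : U.toRight.disjSum (Finset.univ : Finset (Fin 3)) ⊆
        Finset.univ.filter fun b => ∃ a ∈ U, LinkRel r x y a b := by
      rintro (t | j) ht
      · rw [Finset.inl_mem_disjSum] at ht
        exact Finset.mem_filter.2 ⟨Finset.mem_univ _, .inr t, Finset.mem_toRight.1 ht, .inl rfl⟩
      · exact Finset.mem_filter.2 ⟨Finset.mem_univ _, .inr u, Finset.mem_toRight.1 hu, hu'⟩
    have h := Finset.card_le_card this
    rw [Finset.card_disjSum, Finset.card_univ, Fintype.card_fin] at h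
    omega
  push Not at hy
  set T : Finset V := Finset.univ.filter fun t => t ∉ U.toRight ∧ t ≠ x ∧ t ≠ y ∧
    (r x t ∨ ∃ u ∈ U.toRight, u ≠ x ∧ u ≠ y ∧ r u t) with hT
  have hTmem : ∀ t, t ∈ T ↔ t ∉ U.toRight ∧ t ≠ x ∧ t ≠ y ∧
    (r x t ∨ ∃ u ∈ U.toRight, u ≠ x ∧ u ≠ y ∧ r u t) := fun t => by simp [hT]
  have hT3 : 3 ≤ T.card := by
    by_contra hlt
    -- This is where five vertices are needed: `T` has at most two, and `x`, `y` are two more.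
    obtain ⟨z, hz⟩ : ∃ z, z ∉ insert x (insert y T) := by
      by_contra hall
      push Not at hall
      have h1 := Finset.card_le_card (fun z _ => hall z : Finset.univ ⊆ insert x (insert y T))
      have h2 := Finset.card_insert_le x (insert y T)
      have h3 := Finset.card_insert_le y T
      rw [Finset.card_univ, ← Nat.card_eq_fintype_card] at h1
      omega
    simp only [Finset.mem_insert, not_or] at hz
    obtain ⟨hzx, hzy, hzT⟩ := hz
    have hxT : x ∉ T := fun h => ((hTmem x).1 h).2.1 rfl
    have hyT : y ∉ T := fun h => ((hTmem y).1 h).2.2.1 rfl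
    have hins : ∀ w, (insert w T).card < 4 := fun w => by
      have := Finset.card_insert_le w T
      omega
    -- Deleting `x` or `y` along with `T` neutralises a direct arc from `x` to `y`. The side of `z`
    -- decides which end to delete; at most three vertices go.
    by_cases hzU : z ∈ U.toRight
    · obtain ⟨u, ⟨hu, hux, huy⟩, v, hv, -, hvT, huv⟩ := hr (insert x T) (hins x)
        {u | u ∈ U.toRight ∧ u ≠ x ∧ u ≠ y} ⟨z, ⟨hzU, hzx, hzy⟩, by simp [hzx, hzT]⟩
        ⟨y, fun h => h.2.2 rfl, by simp [hyT, Ne.symm hxy]⟩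
      simp only [Finset.mem_insert, not_or] at hvT
      by_cases hvy : v = y
      · subst hvy; exact hy u hu hux huy huv
      · exact hvT.2 ((hTmem v).2 ⟨fun h => hv ⟨h, hvT.1, hvy⟩, hvT.1, hvy,
          .inr ⟨u, hu, hux, huy, huv⟩⟩)
    · obtain ⟨u, hu, v, hv, huT, hvT, huv⟩ := hr (insert y T) (hins y)
        {u | u = x ∨ u ∈ U.toRight ∧ u ≠ x ∧ u ≠ y} ⟨x, .inl rfl, by simp [hxT, hxy]⟩
        ⟨z, fun h => h.elim hzx fun h => hzU h.1, by simp [hzy, hzT]⟩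
      simp only [Finset.mem_insert, not_or] at hvT
      simp only [Set.mem_ofPred_eq, not_or, not_and, not_not] at hv
      refine hvT.2 ((hTmem v).2 ⟨fun h => hvT.1 (hv.2 h hv.1), hv.1, hvT.1, ?_⟩)
      rcases hu with rfl | ⟨hu, hux, huy⟩
      exacts [.inl huv, .inr ⟨u, hu, hux, huy, huv⟩]
  have hdisj : Disjoint U.toRight T :=
    Finset.disjoint_left.2 fun t ht ht' => ((hTmem t).1 ht').1 ht
  have : (U.toRight ∪ T).map Function.Embedding.inl ⊆
      Finset.univ.filter fun b => ∃ a ∈ U, LinkRel r x y a b := by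
    intro t ht
    obtain ⟨u, hu, rfl⟩ := Finset.mem_map.1 ht
    refine Finset.mem_filter.2 ⟨Finset.mem_univ _, ?_⟩
    rcases Finset.mem_union.1 hu with hu | hu
    · exact ⟨.inr u, Finset.mem_toRight.1 hu, .inl rfl⟩
    · obtain ⟨-, hux, huy, h | ⟨w, hw, hwx, hwy, hwu⟩⟩ := (hTmem u).1 hu
      · exact ⟨.inl i, hi', hux, huy, h⟩
      · exact ⟨.inr w, Finset.mem_toRight.1 hw, .inr ⟨hwx, hwy, hux, huy, hwu⟩⟩
  have h := Finset.card_le_card this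
  rw [Finset.card_map, Finset.card_union_of_disjoint hdisj] at h
  omega

/-- `LinkReach f i t`: the vertex `t` lies on the `i`-th path of the linkage `f`. -/
inductive LinkReach (f : Fin 3 ⊕ V → V ⊕ Fin 3) (i : Fin 3) : V → Prop
  | base {t : V} : f (.inl i) = .inl t → LinkReach f i t
  | step {t t' : V} : LinkReach f i t → f (.inr t) = .inl t' → LinkReach f i t'

/-- Injectivity of `f` allows tracing back from `t` in only one way. -/
theorem LinkReach.unique {f : Fin 3 ⊕ V → V ⊕ Fin 3} (hf : Function.Injective f) {i j : Fin 3}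
    {t : V} (hi : LinkReach f i t) (hj : LinkReach f j t) : i = j := by
  induction hi with
  | base h =>
    cases hj with
    | base h' => exact Sum.inl_injective (hf (h.trans h'.symm))
    | step _ h' => exact absurd (hf (h.trans h'.symm)) (by simp)
  | step _ h ih =>
    cases hj with
    | base h' => exact absurd (hf (h.trans h'.symm)) (by simp)
    | step hj h' =>
      obtain rfl := Sum.inr_injective (hf (h.trans h'.symm))
      exact ih hj

theorem LinkReach.ne {f : Fin 3 ⊕ V → V ⊕ Fin 3} (hfr : ∀ p, LinkRel r x y p (f p)) {i : Fin 3}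
    {t : V} (h : LinkReach f i t) : t ≠ x ∧ t ≠ y := by
  induction h with
  | base h =>
    have := hfr (.inl i)
    rw [h] at this
    exact ⟨this.1, this.2.1⟩
  | @step t t' _ h ih =>
    have := hfr (.inr t)
    rw [h] at this
    rcases this with rfl | h
    exacts [ih, ⟨h.2.2.1, h.2.2.2.1⟩]

theorem exists_path_of_linkage [Finite V] {f : Fin 3 ⊕ V → V ⊕ Fin 3}
    (hf : Function.Injective f) (hfr : ∀ p, LinkRel r x y p (f p)) (hr : ∀ u, r u u) (i : Fin 3) :
    ∃ l : List V, l ≠ [] ∧ (x :: (l ++ [y])).IsChain r ∧ l.Nodup ∧ ∀ z ∈ l, LinkReach f i z := by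
  obtain ⟨t₀, ht₀⟩ : ∃ t, f (.inl i) = .inl t := by
    have := hfr (.inl i)
    cases h : f (.inl i) with
    | inl t => exact ⟨t, rfl⟩
    | inr j => rw [h] at this; exact this.elim
  have hxt : r x t₀ := by
    have := hfr (.inl i)
    rw [ht₀] at this
    exact this.2.2
  have hbase : LinkReach f i t₀ := .base ht₀
  obtain ⟨t, ht, j, hj⟩ : ∃ t, LinkReach f i t ∧ ∃ j, f (.inr t) = .inr j := by
    by_contra hcon
    push Not at hcon
    have hnext : ∀ t : {t // LinkReach f i t}, ∃ t' : {t // LinkReach f i t},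
        f (.inr t.1) = .inl t'.1 := by
      intro t
      cases h : f (.inr t.1) with
      | inl t' => exact ⟨⟨t', .step t.2 h⟩, rfl⟩
      | inr j => exact absurd h (hcon t.1 t.2 j)
    choose g hg using hnext
    have hinj : Function.Injective g := fun a b hab =>
      Subtype.ext (Sum.inr_injective (hf ((hg a).trans (by rw [hab, hg b]))))
    -- If the path never reached a copy of `y`, `f` would permute its finite vertex set; but `t₀` is
    -- already the image of a copy of `x`.
    obtain ⟨t, ht⟩ := Finite.surjective_of_injective hinj ⟨t₀, hbase⟩
    have := hg t
    rw [ht, ← ht₀] at this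
    exact absurd (hf this) (by simp)
  have hty : r t y := by
    have := hfr (.inr t)
    rw [hj] at this
    exact this.2.2
  have hreach : ReachIn r {z | LinkReach f i z} t₀ t := by
    clear hj hty j
    induction ht with
    | base h =>
      obtain rfl := Sum.inl_injective (ht₀.symm.trans h)
      exact .refl
    | @step u u' hu h ih =>
      refine .tail ih ⟨?_, LinkReach.step hu h⟩
      have := hfr (.inr u)
      rw [h] at this
      rcases this with rfl | h
      exacts [hr u, h.2.2.2.2]
  obtain ⟨l, hl, hn, hS, hlast⟩ := hreach.exists_path hbase
  refine ⟨t₀ :: l, by simp, ?_, hn, hS⟩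
  refine isChain_between hl (by simp) (fun c hc => ?_) fun c hc => ?_
  · obtain rfl : t₀ = c := by simpa using hc
    exact hxt
  · rw [hlast] at hc
    obtain rfl : t = c := by simpa using hc
    exact hty

theorem exists_pathSystem [Finite V] (hV : 5 ≤ Nat.card V) (hr : StrongWithoutFew r 4)
    (hrefl : ∀ u, r u u) (hxy : x ≠ y) : ∃ A, IsPathSystem r x y A := by
  obtain ⟨f, hf, hfr⟩ := exists_linkage hV hr hxy
  choose A hne hch hn hA using exists_path_of_linkage hf hfr hrefl
  exact ⟨A, hne, hch, hn, fun i j hij z hi hj => hij ((hA i z hi).unique hf (hA j z hj)),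
    fun i h => ((hA i x h).ne hfr).1 rfl, fun i h => ((hA i y h).ne hfr).2 rfl⟩

end TotalRelation

/-! ### Back to generalized paths -/

namespace Digraph

theorem KStrong.strongWithoutFew {V : Type*} {D : Digraph V} {k : ℕ} (h : D.KStrong k) :
    TotalRelation.StrongWithoutFew D.Adj k := by
  rintro X hX S ⟨a, ha, haX⟩ ⟨b, hb, hbX⟩
  obtain ⟨p, hp⟩ := h.2 X hX ⟨a, haX⟩ ⟨b, hbX⟩ (fun h => hb (by
    rw [Subtype.mk.injEq] at h; exact h ▸ ha))
  -- A path that starts in `S` and meets its complement has an arc leaving `S`.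
  have key : ∀ (p : List {v // v ∉ (X : Set V)}) (u : {v // v ∉ (X : Set V)}), u.1 ∈ S →
      (u :: p).IsChain (D.deleteVertices (X : Set V)).Adj → (∃ w ∈ u :: p, w.1 ∉ S) →
      ∃ u ∈ S, ∃ v, v ∉ S ∧ u ∉ X ∧ v ∉ X ∧ D.Adj u v := by
    intro p
    induction p with
    | nil =>
      rintro u hu - ⟨w, hw, hwS⟩
      rw [List.mem_singleton] at hw
      exact absurd (hw ▸ hu) hwS
    | cons c p ih =>
      rintro u hu hch ⟨w, hw, hwS⟩
      rw [List.isChain_cons_cons] at hch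
      by_cases hc : c.1 ∈ S
      · rcases List.mem_cons.1 hw with rfl | hw
        · exact absurd hu hwS
        · exact ih c hc hch.2 ⟨w, hw, hwS⟩
      · exact ⟨u, hu, c, hc, u.2, c.2, hch.1⟩
  obtain ⟨p', rfl⟩ : ∃ p', p = ⟨a, haX⟩ :: p' := by
    have := hp.head_eq
    cases p with
    | nil => simp at this
    | cons c p => simp at this; exact ⟨p, by rw [this]⟩
  exact key p' _ ha hp.chain ⟨⟨b, hbX⟩, List.mem_of_getLast? hp.last_eq, hb⟩

/-- A sequence of vertices in which consecutive vertices are adjacent or lie in the same partite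
set splits into the paths of a generalized path. -/
theorem exists_flatten_of_isChain {V : Type*} (D : Digraph V) (P : Setoid V) (l : List V) (u : V)
    (h : (u :: l).IsChain fun a b => D.Adj a b ∨ P a b) :
    ∃ (p : List V) (L : List (List V)), ((u :: p) :: L).flatten = u :: l ∧
      (∀ q ∈ (u :: p) :: L, q ≠ [] ∧ q.IsChain D.Adj) ∧
      ((u :: p) :: L).IsChain (fun p q => ∃ v ∈ p.getLast?, ∃ u ∈ q.head?, P v u) := by
  induction l generalizing u with
  | nil => exact ⟨[], [], by simp⟩
  | cons c l ih =>
    rw [List.isChain_cons_cons] at h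
    obtain ⟨p, L, hflat, hL, hlink⟩ := ih c h.2
    rcases h.1 with hadj | hP
    · refine ⟨c :: p, L, by simpa using hflat, ?_, ?_⟩
      · intro q hq
        rcases List.mem_cons.1 hq with rfl | hq
        · exact ⟨by simp, List.isChain_cons_cons.2 ⟨hadj, (hL (c :: p) (by simp)).2⟩⟩
        · exact hL q (by simp [hq])
      · rw [List.isChain_cons] at hlink ⊢
        simpa only [List.getLast?_cons_cons] using hlink
    · refine ⟨[], (c :: p) :: L, by simpa using hflat, ?_, ?_⟩
      · intro q hq
        rcases List.mem_cons.1 hq with rfl | hq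
        · simp
        · exact hL q hq
      · exact List.isChain_cons_cons.2 ⟨⟨u, by simp, c, by simp, hP⟩, hlink⟩

end Digraph

theorem mainTheorem9 {V : Type*} [Finite V] (D : Digraph V) (P : Setoid V)
    (hD : D.IsSemicompleteMultipartite P) (h4 : D.KStrong 4) (x y : V) (hxy : x ≠ y) :
    ∃ L : List (List V), D.IsGPath P x y L ∧ ∀ v : V, ∃ p ∈ L, v ∈ p := by
  set r : V → V → Prop := fun a b => D.Adj a b ∨ P a b with hr
  have ht : ∀ u v, r u v ∨ r v u := by
    intro u v
    by_cases h : P u v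
    · exact .inl (.inr h)
    · exact (hD.adj_or_adj u v h).imp .inl .inl
  have hs : TotalRelation.StrongWithoutFew r 4 := fun X hX S ha hb => by
    obtain ⟨u, hu, v, hv, huX, hvX, huv⟩ := h4.strongWithoutFew X hX S ha hb
    exact ⟨u, hu, v, hv, huX, hvX, .inl huv⟩
  obtain ⟨l, hl, hn, hall, hh, hlast⟩ := TotalRelation.hasHamPath_of_pathSystem ht hxy
    (hs.strongWithout (by norm_num) x) (hs.strongWithout (by norm_num) y)
    (TotalRelation.exists_pathSystem h4.1 hs (fun u => .inr (P.refl u)) hxy)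
  obtain ⟨l, rfl⟩ : ∃ l', l = x :: l' := by
    cases l with
    | nil => simp at hh
    | cons c l => simp at hh; exact ⟨l, by rw [hh]⟩
  obtain ⟨p, L, hflat, hL, hlink⟩ := D.exists_flatten_of_isChain P l x hl
  rw [← hflat] at hn hall hlast
  -- Distinctness of the whole sequence gives both distinct vertices within each path and
  -- disjointness between paths.
  rw [List.nodup_flatten] at hn
  refine ⟨(x :: p) :: L, ⟨fun q hq => ?_, hn.2, hlink, ⟨_, rfl, rfl⟩, ?_⟩, fun v => ?_⟩
  · obtain ⟨hne, hch⟩ := hL q hq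
    exact ⟨_, _, List.head?_eq_some_head hne, List.getLast?_eq_some_getLast hne, hn.1 q hq, hch⟩
  · have hne : (x :: p) :: L ≠ [] := by simp
    refine ⟨_, List.getLast?_eq_some_getLast hne, ?_⟩
    rw [← List.dropLast_append_getLast hne, List.flatten_append,
      List.flatten_singleton, List.getLast?_append_of_ne_nil _ (hL _ (List.getLast_mem hne)).1] at hlast
    exact hlast
  · simpa only [List.mem_flatten] using hall v
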